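/- Let $p\ge 1$, $w\ge 1$, $n\ge 1$ be integers and let $a(t)=\sum_{k=p-w}^{p}a_kt^k$ be a Laurent polynomial with complex coefficients and $a_p\ne 0$ (put $a_k=0$ for $k>p$ and for $k<p-w$). Let $T_n(a)=[a_{j-k}]_{j,k=1}^n$ be the corresponding banded Toeplitz matrix and let $x$ be an eigenvalue of $T_n(a)$. Then $a-x$ has exactly $w$ zeros $z_1,\dots,z_w\in\mathbb{C}$, counted with multiplicity, in the sense that $a(t)-x=a_p\,t^{p-w}\prod_{j=1}^{w}(t-z_j)$ (so some $z_j$ may be $0$), and the vector $v=[v_r]_{r=1}^n$ with components \[ v_r=s_{((n-1)^{p-1},\,n-r)}(z_1,\dots,z_w) \] satisfies $T_n(a)v=xv$. Here $((n-1)^{p-1},n-r)$ is the partition consisting of $p-1$ parts equal to $n-1$ followed by the part $n-r$, and $s_\lambda=\det[h_{\lambda_j-j+k}]_{j,k=1}^{\ell(\lambda)}$ is the Schur polynomial of the partition $\lambda$, where $\ell(\lambda)$ is the number of parts of $\lambda$, $h_m$ is the complete homogeneous symmetric polynomial of degree $m$, and $h_m=0$ for $m<0$. (The vector $v$ is not claimed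 to be nonzero.) If moreover $1\le p\le w$ and the zeros $z_1,\dots,z_w$ are pairwise distinct, then there are complex numbers $C_1,\dots,C_w$, not depending on $r$, such that \[ v_r=\sum_{j=1}^{w}C_j\,z_j^{\,n-r+w-p}\qquad(r=1,\dots,n) \] (with $0^0=1$); explicitly, one can take \[ C_j=\frac{(-1)^{p-1}\,(\operatorname{adj}D)_{j,1}}{V}, \qquad D=\bigl[z_k^{\lambda_i+w-i}\bigr]_{i,k=1}^{w}, \qquad V=\prod_{1\le j<k\le w}(z_j-z_k), \] where $\lambda=(n^p,0^{w-p})$, that is, $\lambda_i=n$ for $i\le p$ and $\lambda_i=0$ for $p<i\le w$. -/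

import Mathlib

open scoped LaurentPolynomial

noncomputable section

/-- `a(t) = ∑_{k=p-w}^{p} a_k t^k` with `a_p ≠ 0`. The coefficient `a_{p-w}` may vanish. -/
def IsBandedSymbol (p w : ℕ) (a : ℂ[T;T⁻¹]) : Prop :=
  a.coeff (p : ℤ) ≠ 0 ∧ ∀ k : ℤ, k < (p : ℤ) - (w : ℤ) ∨ (p : ℤ) < k → a.coeff k = 0

/-- `z_1, …, z_w` is the list of zeros (with multiplicities) of the Laurent polynomial `b` of the
form `∑_{k=p-w}^{p} b_k t^k`: `b(t) = b_p t^{p-w} ∏_j (t - z_j)`. -/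
def IsZeroList (p w : ℕ) (b : ℂ[T;T⁻¹]) (z : Fin w → ℂ) : Prop :=
  b = LaurentPolynomial.C (b.coeff (p : ℤ)) * LaurentPolynomial.T ((p : ℤ) - (w : ℤ)) *
    ∏ j : Fin w, (LaurentPolynomial.T 1 - LaurentPolynomial.C (z j))

/-- The Toeplitz matrix `T_n(a) = [a_{j-k}]_{j,k=1}^n`. -/
def toeplitz (n : ℕ) (a : ℂ[T;T⁻¹]) : Matrix (Fin n) (Fin n) ℂ :=
  Matrix.of fun j k => a.coeff ((j : ℤ) - (k : ℤ))

/-- The complete homogeneous symmetric polynomial `h_k` in `w` variables, for an integer `k`;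
it is zero for `k < 0`. -/
def completeHomogeneous (w : ℕ) (k : ℤ) : MvPolynomial (Fin w) ℂ :=
  if 0 ≤ k then MvPolynomial.hsymm (Fin w) ℂ k.toNat else 0

/-- The Schur polynomial `s_l` in `w` variables of the partition `l = (l_1 ≥ l_2 ≥ … ≥ 0)`
(trailing zeros allowed), by the Jacobi-Trudi formula `s_l = det [h_{l_j - j + k}]_{j,k}`. -/
def schurPoly (w : ℕ) (l : List ℕ) : MvPolynomial (Fin w) ℂ :=
  Matrix.det (Matrix.of fun j k : Fin l.length =>
    completeHomogeneous w ((l.get j : ℤ) - (j : ℤ) + (k : ℤ)))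

/-- The value `s_l(z_1, …, z_w)`. -/
def schurEval {w : ℕ} (l : List ℕ) (z : Fin w → ℂ) : ℂ :=
  MvPolynomial.eval z (schurPoly w l)

/-- The generalized Vandermonde matrix `A_l(z_1, …, z_w) = [z_k^{l_j + w - j}]_{j,k=1}^w`, for a
partition `l` of length at most `w`, extended by zeros. Here `j` runs from `0` to `w - 1`, so
that the exponent `w - j` becomes `w - 1 - j`. -/
def genVandermonde {w : ℕ} (l : List ℕ) (z : Fin w → ℂ) : Matrix (Fin w) (Fin w) ℂ :=
  Matrix.of fun j k => z k ^ (l.getD (j : ℕ) 0 + (w - 1 - (j : ℕ)))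

/-- The constants `C_j = (-1)^{p-1} adj(D)_{j,1} / V`, where `D = A_{(n^p)}(z_1, …, z_w)` and
`V = det A_{(0^w)}(z_1, …, z_w) = ∏_{j<k} (z_j - z_k)`. -/
def trenchCoeff (n p : ℕ) {w : ℕ} (z : Fin w → ℂ) (j : Fin w) : ℂ :=
  (-1) ^ (p - 1) * (genVandermonde (List.replicate p n) z).adjugate j ⟨0, j.pos⟩ /
    (genVandermonde [] z).det

end

/-!
Let `E = ∏ (1 - z_j X)` and `H = 1 / E = ∑ h_m X ^ m`. The biinfinite upper triangular Toeplitz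
matrices of `E` and `H` are inverse to each other, and `T_n(a - x)` is `a_p` times an `n × n` window
of the first. The complementary window of the second is the Jacobi–Trudi matrix of the rectangle
`(n^p)`, so it is singular along with `T_n(a - x)`.

The Jacobi–Trudi matrix of `((n - 1)^{p-1}, n - r)` arises from that of `(n^p)` by replacing the
first row and cycling the rows. Hence `v` is, up to sign, a window of the matrix of `H` applied to
the first column of the adjugate of that singular matrix, and `T_n(a - x)` sends it to a combination
of the rows of the singular matrix, all of which annihilate this column.

The generalized Vandermonde matrices are built in the same way from rows that do not depend on the
partition. The same row cycling, together with the bialternant formula, expands `v` in powers of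
the zeros.
-/

noncomputable section

open scoped Matrix Polynomial PowerSeries LaurentSeries

section ToeplitzBlocks

theorem coeff_coe_of_neg {R : Type*} [Semiring R] (f : R⟦X⟧) {k : ℤ} (hk : k < 0) :
    (f : R⸨X⸩).coeff k = 0 := by
  rw [PowerSeries.coeff_coe, if_pos hk]

variable {R : Type*} [CommRing R]

theorem sum_range_coeff_mul_coeff (f g : R⟦X⟧) (M j : ℕ) {N : ℤ} (hN : N < M) :
    ∑ s ∈ Finset.range M, (f : R⸨X⸩).coeff (s - j) * (g : R⸨X⸩).coeff (N - s) =
      ((f * g : R⟦X⟧) : R⸨X⸩).coeff (N - j) := by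
  have nonneg_of_mem_support (φ : R⟦X⟧) {k : ℤ} (hk : k ∈ (φ : R⸨X⸩).support) : 0 ≤ k := by
    by_contra! h
    exact hk (coeff_coe_of_neg φ h)
  rw [PowerSeries.coe_mul, HahnSeries.coeff_mul]
  symm
  refine Finset.sum_of_injOn (fun ij => (ij.1 + j).toNat) ?_ ?_ ?_ ?_
  · rintro ⟨k, l⟩ hkl ⟨k', l'⟩ hkl' h
    simp only [Finset.mem_coe, Finset.mem_antidiagonal] at hkl hkl'
    have := nonneg_of_mem_support f hkl.1
    have := nonneg_of_mem_support f hkl'.1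
    grind
  · rintro ⟨k, l⟩ hkl
    simp only [Finset.mem_coe, Finset.mem_antidiagonal, Finset.mem_range] at hkl ⊢
    have := nonneg_of_mem_support f hkl.1
    have := nonneg_of_mem_support g hkl.2.1
    lia
  · intro s _ hs
    by_contra hne
    refine hs ⟨((s : ℤ) - j, N - s), ?_, by simp⟩
    rw [Finset.mem_coe, Finset.mem_antidiagonal]
    exact ⟨left_ne_zero_of_mul hne, right_ne_zero_of_mul hne, by ring⟩
  · rintro ⟨k, l⟩ hkl
    rw [Finset.mem_antidiagonal] at hkl
    have := nonneg_of_mem_support f hkl.1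
    congr 2 <;> lia

/-- A rectangular window, of size `m × n`, of the upper triangular biinfinite Toeplitz matrix
`[f_{j-i}]` of a power series `f`: its top left entry lies on the diagonal `j - i = d`. Reading the
coefficients in the Laurent series ring makes `f_k = 0` for `k < 0`. -/
def toeplitzBlock (f : R⟦X⟧) (d : ℤ) (m n : ℕ) : Matrix (Fin m) (Fin n) R :=
  Matrix.of fun i j => (f : R⸨X⸩).coeff (d + (j : ℤ) - (i : ℤ))

theorem toeplitzBlock_one_of_le {m : ℕ} {d : ℤ} (hd : m ≤ d) (n : ℕ) :
    toeplitzBlock (1 : R⟦X⟧) d m n = 0 := by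
  ext i j
  rw [toeplitzBlock, Matrix.of_apply, PowerSeries.coe_one, HahnSeries.coeff_one,
    if_neg (by have := i.2; lia), Matrix.zero_apply]

theorem toeplitzBlock_one_zero (n : ℕ) : toeplitzBlock (1 : R⟦X⟧) 0 n n = 1 := by
  ext i j
  rw [toeplitzBlock, Matrix.of_apply, PowerSeries.coe_one, HahnSeries.coeff_one, Matrix.one_apply]
  congr 1
  grind

-- The windows are the rows `ρ, …, ρ + m - 1` of the biinfinite Toeplitz matrix of `f` and the
-- columns `κ, …, κ + n - 1` of that of `g`. As both matrices are upper triangular, only the indices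
-- `0, …, a + b - 1` contribute to the product.
theorem toeplitzBlock_mul_add_mul (f g : R⟦X⟧) (ρ a b m n : ℕ) {κ : ℤ} (h : κ + n ≤ a + b) :
    toeplitzBlock f (-ρ) m a * toeplitzBlock g κ a n +
        toeplitzBlock f (a - ρ) m b * toeplitzBlock g (κ - a) b n =
      toeplitzBlock (f * g) (κ - ρ) m n := by
  ext i k
  have hconv := sum_range_coeff_mul_coeff f g (a + b) (ρ + i) (N := κ + k)
    (by have := k.2; push_cast; lia)
  rw [Finset.sum_range, Fin.sum_univ_add] at hconv
  simp only [Fin.val_castAdd, Fin.val_natAdd] at hconv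
  simp only [toeplitzBlock, Matrix.add_apply, Matrix.mul_apply, Matrix.of_apply]
  refine (congrArg₂ (· + ·) (Finset.sum_congr rfl fun s _ => ?_)
    (Finset.sum_congr rfl fun s _ => ?_)).trans (hconv.trans ?_)
  · congr 2
    lia
  · congr 2 <;> lia
  · congr 1
    lia

variable {f h : R⟦X⟧} {p n : ℕ}

theorem det_toeplitzBlock_eq_zero_of_mul_eq_one [IsDomain R] (hfh : f * h = 1)
    (hf : (toeplitzBlock f p n n).det = 0) : (toeplitzBlock h n p p).det = 0 := by
  obtain ⟨y, hy, hfy⟩ := Matrix.exists_mulVec_eq_zero_iff.mpr hf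
  have hhf : h * f = 1 := by rw [mul_comm, hfh]
  have htop := toeplitzBlock_mul_add_mul h f 0 n p p n (κ := p) (by lia)
  have hbot := toeplitzBlock_mul_add_mul h f p n p n n (κ := p) (by lia)
  rw [hhf, toeplitzBlock_one_of_le (by simp)] at htop
  rw [hhf, sub_self, toeplitzBlock_one_zero] at hbot
  replace htop := congrArg (Matrix.mulVec · y) htop
  replace hbot := congrArg (Matrix.mulVec · y) hbot
  simp only [Matrix.add_mulVec, ← Matrix.mulVec_mulVec, hfy, Matrix.mulVec_zero, zero_add,
    Matrix.zero_mulVec, Matrix.one_mulVec, Nat.cast_zero, sub_zero] at htop hbot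
  refine Matrix.exists_mulVec_eq_zero_iff.mp ⟨_, fun hc => hy ?_, htop⟩
  rw [← hbot, hc, Matrix.mulVec_zero]

theorem toeplitzBlock_mulVec_eq_neg (hfh : f * h = 1) (c : Fin p → R) :
    toeplitzBlock f p n n *ᵥ (toeplitzBlock h (n - p) n p *ᵥ c) =
      -(toeplitzBlock f 0 n p *ᵥ (toeplitzBlock h n p p *ᵥ c)) := by
  have hprod := toeplitzBlock_mul_add_mul f h 0 p n n p (κ := n) (by lia)
  rw [hfh, toeplitzBlock_one_of_le (by simp), Nat.cast_zero, neg_zero, sub_zero] at hprod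
  rw [eq_neg_iff_add_eq_zero, add_comm, Matrix.mulVec_mulVec, Matrix.mulVec_mulVec,
    ← Matrix.add_mulVec, hprod, Matrix.zero_mulVec]

theorem toeplitzBlock_mulVec_adjugate_col [IsDomain R] (hfh : f * h = 1)
    (hf : (toeplitzBlock f p n n).det = 0) (j : Fin p) :
    toeplitzBlock f p n n *ᵥ
      (toeplitzBlock h (n - p) n p *ᵥ (toeplitzBlock h n p p).adjugate.col j) = 0 := by
  have hcol : toeplitzBlock h n p p *ᵥ (toeplitzBlock h n p p).adjugate.col j = 0 := by
    rw [← Matrix.mulVec_single_one, Matrix.mulVec_mulVec, Matrix.mul_adjugate,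
      det_toeplitzBlock_eq_zero_of_mul_eq_one hfh hf, zero_smul, Matrix.zero_mulVec]
  rw [toeplitzBlock_mulVec_eq_neg hfh, hcol, Matrix.mulVec_zero, neg_zero]

end ToeplitzBlocks

section CompleteHomogeneous

variable {R σ : Type*} [CommRing R]

/-- The polynomial `∏_{j ∈ s} (1 - z_j X)`, the generating function of the signed elementary
symmetric polynomials in the variables indexed by `s`. -/
def esymmPoly (s : Finset σ) (z : σ → R) : R[X] :=
  ∏ j ∈ s, (1 - Polynomial.C (z j) * Polynomial.X)

theorem natDegree_esymmPoly_le (s : Finset σ) (z : σ → R) :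
    (esymmPoly s z).natDegree ≤ s.card := by
  refine (Polynomial.natDegree_prod_le _ _).trans ?_
  rw [Finset.card_eq_sum_ones]
  refine Finset.sum_le_sum fun j _ => ?_
  compute_degree

theorem one_sub_C_mul_X_mul_mk_pow (c : R) :
    ((1 - Polynomial.C c * Polynomial.X : R[X]) : R⟦X⟧) * PowerSeries.mk (fun m => c ^ m) = 1 := by
  ext m
  cases m <;>
    simp [sub_mul, mul_assoc, PowerSeries.coeff_succ_X_mul, PowerSeries.coeff_one, pow_succ']

variable [Fintype σ] [DecidableEq σ]

/-- The generating function `∑ h_m(z) X ^ m` of the complete homogeneous symmetric polynomials. -/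
def hsymmSeries (z : σ → R) : R⟦X⟧ :=
  PowerSeries.mk fun m => MvPolynomial.eval z (MvPolynomial.hsymm σ R m)

theorem hsymmSeries_eq_prod (z : σ → R) :
    hsymmSeries z = ∏ j, PowerSeries.mk fun m => z j ^ m := by
  ext m
  rw [PowerSeries.coeff_prod, hsymmSeries, PowerSeries.coeff_mk, MvPolynomial.hsymm, map_sum]
  refine Finset.sum_bij (fun s _ => (Sym.equivNatSum σ m s : σ →₀ ℕ)) ?_ ?_ ?_ ?_
  · intro s _
    have := (Sym.equivNatSum σ m s).2
    rw [Finsupp.sum_fintype _ _ (by simp)] at this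
    exact Finset.mem_finsuppAntidiag.mpr ⟨this, Finset.subset_univ _⟩
  · intro s _ t _ h
    exact (Sym.equivNatSum σ m).injective (Subtype.ext h)
  · intro l hl
    have h : l.sum (fun _ => id) = m := by
      rw [Finsupp.sum_fintype _ _ (by simp)]
      exact (Finset.mem_finsuppAntidiag.mp hl).1
    exact ⟨(Sym.equivNatSum σ m).symm ⟨l, h⟩, Finset.mem_univ _, by simp⟩
  · intro s _
    rw [map_multiset_prod, Multiset.map_map, Finset.prod_multiset_map_count,
      Finset.prod_subset (Finset.subset_univ _)]
    · simp
    · intro i _ hi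
      rw [Multiset.mem_toFinset] at hi
      rw [Multiset.count_eq_zero_of_notMem hi, pow_zero]

theorem esymmPoly_univ_mul_hsymmSeries (z : σ → R) :
    (esymmPoly Finset.univ z : R⟦X⟧) * hsymmSeries z = 1 := by
  rw [hsymmSeries_eq_prod, esymmPoly, ← Polynomial.coeToPowerSeries.ringHom_apply, map_prod,
    ← Finset.prod_mul_distrib]
  exact Finset.prod_eq_one fun j _ => one_sub_C_mul_X_mul_mk_pow (z j)

theorem esymmPoly_erase_mul_hsymmSeries (z : σ → R) (k : σ) :
    (esymmPoly (Finset.univ.erase k) z : R⟦X⟧) * hsymmSeries z =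
      PowerSeries.mk fun m => z k ^ m := by
  have hgeom := one_sub_C_mul_X_mul_mk_pow (z k)
  have hprod := esymmPoly_univ_mul_hsymmSeries z
  rw [esymmPoly, ← Finset.mul_prod_erase _ _ (Finset.mem_univ k), ← esymmPoly,
    Polynomial.coe_mul] at hprod
  linear_combination -(esymmPoly (Finset.univ.erase k) z : R⟦X⟧) * hsymmSeries z * hgeom +
    PowerSeries.mk (fun m => z k ^ m) * hprod

theorem pow_eq_sum_coeff_hsymmSeries_mul {w : ℕ} (z : Fin w → R) (k : Fin w) (e : ℕ) :
    z k ^ e = ∑ j : Fin w, (hsymmSeries z : R⸨X⸩).coeff (e - w + 1 + (j : ℤ)) *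
      (esymmPoly (Finset.univ.erase k) z).coeff j.rev := by
  have hdeg : (esymmPoly (Finset.univ.erase k) z).natDegree < w :=
    (natDegree_esymmPoly_le _ z).trans_lt (by simpa using k.pos)
  have hconv := sum_range_coeff_mul_coeff (esymmPoly (Finset.univ.erase k) z) (hsymmSeries z)
    (w + (e + 1)) 0 (N := e) (by lia)
  simp only [Nat.cast_zero, sub_zero, esymmPoly_erase_mul_hsymmSeries,
    LaurentSeries.coeff_coe_powerSeries, PowerSeries.coeff_mk, Polynomial.coeff_coe] at hconv
  rw [← hconv, Finset.sum_range_add, Finset.sum_eq_zero (s := Finset.range (e + 1)), add_zero,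
    Finset.sum_range, ← Equiv.sum_comp Fin.revPerm]
  · refine Finset.sum_congr rfl fun j _ => ?_
    rw [Fin.revPerm_apply, mul_comm, Fin.val_rev]
    congr 2
    have := j.isLt
    lia
  · intro s _
    rw [Polynomial.coeff_eq_zero_of_natDegree_lt (hdeg.trans_le (Nat.le_add_right w s)), zero_mul]

end CompleteHomogeneous

section PartitionMatrices

variable {R : Type*} {N : ℕ}

/-- The square matrix whose row `i` (counted from `0`) is `g (l_i - i)`, for a list `l` extended by
zeros. Both the Jacobi–Trudi matrices and the generalized Vandermonde matrices of a partition `l`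
have this form, for rows `g` that do not depend on `l`. -/
def partitionMatrix (g : ℤ → Fin N → R) (l : List ℕ) : Matrix (Fin N) (Fin N) R :=
  Matrix.of fun i => g (l.getD i 0 - (i : ℤ))

-- Cycling row `i₀` to the top moves row `i < i₀` to row `i + 1`, and `n - i = (n + 1) - (i + 1)`.
theorem partitionMatrix_replicate_append (g : ℤ → Fin N → R) (i₀ : Fin N) (n m : ℕ) :
    partitionMatrix g (List.replicate i₀ n ++ [m]) =
      ((partitionMatrix g (List.replicate (i₀ + 1) (n + 1))).updateRow ⟨0, i₀.pos⟩
        (g (m - (i₀ : ℤ)))).submatrix i₀.cycleRange id := by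
  ext i k
  rw [Matrix.submatrix_apply, id]
  rcases lt_trichotomy i i₀ with hi | rfl | hi
  · have hrow : (i₀.cycleRange i : ℕ) = i + 1 := Fin.coe_cycleRange_of_lt hi
    rw [Matrix.updateRow_ne (by simp [Fin.ext_iff, hrow])]
    simp only [partitionMatrix, Matrix.of_apply, hrow]
    rw [List.getD_append _ _ _ _ (by simpa using hi), List.getD_replicate _ (by simpa using hi),
      List.getD_replicate _ (by simpa using hi)]
    congr 1
    push_cast
    ring
  · have hrow : i.cycleRange i = ⟨0, i.pos⟩ := by
      rw [Fin.ext_iff, Fin.coe_cycleRange_of_le le_rfl, if_pos rfl]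
    rw [hrow, Matrix.updateRow_self]
    simp [partitionMatrix]
  · rw [Fin.cycleRange_of_gt hi, Matrix.updateRow_ne (by simp [Fin.ext_iff]; lia)]
    simp only [partitionMatrix, Matrix.of_apply]
    rw [List.getD_eq_default _ _ (by simp; lia), List.getD_eq_default _ _ (by simp; lia)]

variable [CommRing R]

theorem det_partitionMatrix_replicate_append (g : ℤ → Fin N → R) (i₀ : Fin N) (n m : ℕ) :
    (partitionMatrix g (List.replicate i₀ n ++ [m])).det =
      (-1) ^ (i₀ : ℕ) * (g (m - (i₀ : ℤ)) ⬝ᵥ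
        (partitionMatrix g (List.replicate (i₀ + 1) (n + 1))).adjugate.col ⟨0, i₀.pos⟩) := by
  rw [partitionMatrix_replicate_append, Matrix.det_permute, Fin.sign_cycleRange,
    ← Matrix.cramer_transpose_apply, Matrix.cramer_eq_adjugate_mulVec, ← Matrix.adjugate_transpose,
    Matrix.mulVec, dotProduct_comm]
  push_cast
  rfl

end PartitionMatrices

section SchurPolynomials

variable {w : ℕ}

/-- The Jacobi–Trudi matrix `[h_{l_i - i + k}(z)]` of size `N`, for a list `l` extended by zeros. -/
def jacobiTrudi (l : List ℕ) (z : Fin w → ℂ) (N : ℕ) : Matrix (Fin N) (Fin N) ℂ :=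
  partitionMatrix (fun e k => (hsymmSeries z : ℂ⸨X⸩).coeff (e + (k : ℤ))) l

theorem eval_completeHomogeneous (z : Fin w → ℂ) (k : ℤ) :
    MvPolynomial.eval z (completeHomogeneous w k) = (hsymmSeries z : ℂ⸨X⸩).coeff k := by
  rcases lt_or_ge k 0 with hk | hk
  · rw [completeHomogeneous, if_neg hk.not_ge, map_zero, coeff_coe_of_neg _ hk]
  · lift k to ℕ using hk
    rw [completeHomogeneous, if_pos (Int.natCast_nonneg k), LaurentSeries.coeff_coe_powerSeries,
      hsymmSeries, PowerSeries.coeff_mk, Int.toNat_natCast]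

theorem det_jacobiTrudi_succ {l : List ℕ} {N : ℕ} (hl : l.length ≤ N) (z : Fin w → ℂ) :
    (jacobiTrudi l z (N + 1)).det = (jacobiTrudi l z N).det := by
  have hrow (k : Fin (N + 1)) : jacobiTrudi l z (N + 1) (Fin.last N) k =
      (hsymmSeries z : ℂ⸨X⸩).coeff ((k : ℤ) - N) := by
    rw [jacobiTrudi, partitionMatrix, Matrix.of_apply, List.getD_eq_default _ _ (by simpa using hl)]
    rw [Fin.val_last]
    congr 1
    ring
  rw [Matrix.det_succ_row _ (Fin.last N), Fin.sum_univ_castSucc, Finset.sum_eq_zero, zero_add, hrow]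
  · have hsub : (jacobiTrudi l z (N + 1)).submatrix (Fin.last N).succAbove (Fin.last N).succAbove =
        jacobiTrudi l z N := by
      ext i k
      simp [jacobiTrudi, partitionMatrix]
    have hone : (hsymmSeries z : ℂ⸨X⸩).coeff ((Fin.last N : ℕ) - (N : ℤ)) = 1 := by
      rw [Fin.val_last, sub_self, ← Nat.cast_zero, LaurentSeries.coeff_coe_powerSeries,
        hsymmSeries, PowerSeries.coeff_mk, MvPolynomial.hsymm_zero, map_one]
    rw [hone, hsub, Even.neg_one_pow ⟨_, rfl⟩, one_mul, one_mul]
  · intro k _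
    rw [hrow, coeff_coe_of_neg _ (by simp), mul_zero, zero_mul]

theorem schurEval_eq_det_jacobiTrudi {l : List ℕ} {N : ℕ} (hl : l.length ≤ N) (z : Fin w → ℂ) :
    schurEval l z = (jacobiTrudi l z N).det := by
  induction N, hl using Nat.le_induction with
  | base =>
    rw [schurEval, schurPoly, RingHom.map_det]
    congr 1
    ext i k
    simp [eval_completeHomogeneous, jacobiTrudi, partitionMatrix]
  | succ N hN ih => rw [ih, det_jacobiTrudi_succ hN]

theorem jacobiTrudi_replicate (z : Fin w → ℂ) (n p : ℕ) :
    jacobiTrudi (List.replicate p n) z p = toeplitzBlock (hsymmSeries z) n p p := by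
  ext i k
  simp only [jacobiTrudi, partitionMatrix, toeplitzBlock, Matrix.of_apply]
  rw [List.getD_replicate _ i.isLt]
  congr 1
  ring

theorem schurEval_replicate_append_eq_mulVec (z : Fin w → ℂ) (q n : ℕ) :
    (fun r : Fin (n + 1) => schurEval (List.replicate q n ++ [n + 1 - (r + 1)]) z) =
      (-1 : ℂ) ^ q •
        (toeplitzBlock (hsymmSeries z) ((n + 1 : ℕ) - (q + 1 : ℕ)) (n + 1) (q + 1) *ᵥ
          (toeplitzBlock (hsymmSeries z) (n + 1 : ℕ) (q + 1) (q + 1)).adjugate.col 0) := by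
  ext r
  have hdet := det_partitionMatrix_replicate_append
    (fun e (k : Fin (q + 1)) => (hsymmSeries z : ℂ⸨X⸩).coeff (e + (k : ℤ))) (Fin.last q) n
    (n + 1 - (r + 1))
  rw [Fin.val_last] at hdet
  rw [schurEval_eq_det_jacobiTrudi (N := q + 1) (by simp), jacobiTrudi, hdet,
    ← jacobiTrudi_replicate, jacobiTrudi, Pi.smul_apply, smul_eq_mul, Matrix.mulVec]
  congr 2
  ext k
  simp only [toeplitzBlock, Matrix.of_apply]
  congr 1
  lia

theorem genVandermonde_eq_partitionMatrix (l : List ℕ) (z : Fin w → ℂ) :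
    genVandermonde l z = partitionMatrix (fun e k => z k ^ (e + w - 1).toNat) l := by
  ext i k
  simp only [genVandermonde, partitionMatrix, Matrix.of_apply]
  congr 1
  lia

theorem genVandermonde_eq_jacobiTrudi_mul (l : List ℕ) (z : Fin w → ℂ) :
    genVandermonde l z = jacobiTrudi l z w *
      Matrix.of fun j k => (esymmPoly (Finset.univ.erase k) z).coeff j.rev := by
  ext i k
  rw [Matrix.mul_apply, genVandermonde, Matrix.of_apply, pow_eq_sum_coeff_hsymmSeries_mul]
  refine Finset.sum_congr rfl fun j _ => ?_
  simp only [jacobiTrudi, partitionMatrix, Matrix.of_apply]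
  congr 2
  have := i.isLt
  lia

theorem det_genVandermonde {l : List ℕ} (hl : l.length ≤ w) (z : Fin w → ℂ) :
    (genVandermonde l z).det = schurEval l z * (genVandermonde [] z).det := by
  have schurEval_nil : schurEval [] z = 1 := by
    rw [schurEval, schurPoly, Matrix.det_fin_zero, map_one]
  rw [genVandermonde_eq_jacobiTrudi_mul l, genVandermonde_eq_jacobiTrudi_mul [], Matrix.det_mul,
    Matrix.det_mul, ← schurEval_eq_det_jacobiTrudi hl,
    ← schurEval_eq_det_jacobiTrudi (Nat.zero_le w), schurEval_nil, one_mul]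

theorem det_genVandermonde_nil_ne_zero {z : Fin w → ℂ} (hz : Function.Injective z) :
    (genVandermonde [] z).det ≠ 0 := by
  have hvand : genVandermonde [] z = (Matrix.vandermonde z).transpose.submatrix Fin.revPerm id := by
    ext i k
    simp only [genVandermonde, Matrix.of_apply, Matrix.submatrix_apply, Matrix.transpose_apply,
      Matrix.vandermonde_apply, List.getD_nil, Fin.revPerm_apply, Fin.val_rev, id]
    congr 1
    lia
  rw [hvand, Matrix.det_permute, Matrix.det_transpose]
  exact mul_ne_zero (by exact_mod_cast (Equiv.Perm.sign _).ne_zero)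
    (Matrix.det_vandermonde_ne_zero_iff.mpr hz)

theorem schurEval_replicate_append_eq_sum_trenchCoeff {q : ℕ} (hq : q + 1 ≤ w) (n m : ℕ)
    {z : Fin w → ℂ} (hz : Function.Injective z) :
    schurEval (List.replicate q n ++ [m]) z =
      ∑ j, trenchCoeff (n + 1) (q + 1) z j * z j ^ (m + (w - (q + 1))) := by
  have hexp : ((m : ℤ) - q + w - 1).toNat = m + (w - (q + 1)) := by lia
  have hdet := det_partitionMatrix_replicate_append
    (fun e (k : Fin w) => z k ^ (e + w - 1).toNat) ⟨q, hq⟩ n m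
  rw [← genVandermonde_eq_partitionMatrix, ← genVandermonde_eq_partitionMatrix,
    det_genVandermonde (by simpa using hq), hexp] at hdet
  rw [eq_div_of_mul_eq (det_genVandermonde_nil_ne_zero hz) hdet, dotProduct, Finset.mul_sum,
    Finset.sum_div]
  refine Finset.sum_congr rfl fun j _ => ?_
  rw [trenchCoeff, Nat.add_sub_cancel, Matrix.col_apply]
  ring

end SchurPolynomials

section LaurentPolynomials

section Semiring

variable {R : Type*} [Semiring R]

theorem coeff_toLaurent_eq_coeff_coe (f : R[X]) (k : ℤ) :
    (Polynomial.toLaurent f).coeff k = ((f : R⟦X⟧) : R⸨X⸩).coeff k := by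
  rw [LaurentPolynomial.coeff_toLaurent]
  rcases lt_or_ge k 0 with hk | hk
  · rw [coeff_coe_of_neg _ hk, Finsupp.mapDomain_of_notMem_range]
    rintro ⟨m, rfl⟩
    exact hk.not_ge (Int.natCast_nonneg m)
  · lift k to ℕ using hk
    rw [LaurentSeries.coeff_coe_powerSeries, Polynomial.coeff_coe]
    exact Finsupp.mapDomain_apply Nat.castEmbedding.injective _ _

theorem coeff_T_mul (m : ℤ) (f : R[T;T⁻¹]) (k : ℤ) :
    (LaurentPolynomial.T m * f).coeff k = f.coeff (k - m) := by
  obtain ⟨d, rfl⟩ : ∃ d, k = m + d := ⟨k - m, by ring⟩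
  rw [LaurentPolynomial.T, AddMonoidAlgebra.coeff_single_mul_add, one_mul, add_sub_cancel_left]

theorem toLaurent_trunc {f : R[T;T⁻¹]} (hf : ∀ k < 0, f.coeff k = 0) :
    Polynomial.toLaurent (LaurentPolynomial.trunc f) = f := by
  refine LaurentPolynomial.ext fun k => ?_
  rw [coeff_toLaurent_eq_coeff_coe]
  rcases lt_or_ge k 0 with hk | hk
  · rw [coeff_coe_of_neg _ hk, hf k hk]
  · lift k to ℕ using hk
    rw [LaurentSeries.coeff_coe_powerSeries, Polynomial.coeff_coe]
    rfl

end Semiring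

theorem prod_T_one_sub_C {R σ : Type*} [CommRing R] (s : Finset σ) (z : σ → R) :
    ∏ j ∈ s, (LaurentPolynomial.T 1 - LaurentPolynomial.C (z j)) =
      LaurentPolynomial.T (s.card : ℤ) *
        LaurentPolynomial.invert (Polynomial.toLaurent (esymmPoly s z)) := by
  have hfactor (j : σ) : LaurentPolynomial.T 1 - LaurentPolynomial.C (z j) =
      LaurentPolynomial.T 1 * LaurentPolynomial.invert
        (Polynomial.toLaurent (1 - Polynomial.C (z j) * Polynomial.X)) := by
    rw [map_sub, map_sub, map_mul, map_mul, Polynomial.toLaurent_C, Polynomial.toLaurent_X,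
      LaurentPolynomial.invert_C, LaurentPolynomial.invert_T, map_one, map_one, mul_sub, mul_one,
      mul_left_comm, ← LaurentPolynomial.T_add, add_neg_cancel, LaurentPolynomial.T_zero, mul_one]
  rw [Finset.prod_congr rfl fun j _ => hfactor j, Finset.prod_mul_distrib, Finset.prod_const,
    LaurentPolynomial.T_pow, mul_one, esymmPoly, map_prod, map_prod]

theorem exists_eq_C_leadingCoeff_mul_prod_X_sub_C {K : Type*} [Field K] {P : K[X]}
    (hP : P.Splits) {w : ℕ} (hw : P.natDegree = w) :
    ∃ z : Fin w → K,
      P = Polynomial.C P.leadingCoeff * ∏ j, (Polynomial.X - Polynomial.C (z j)) := by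
  have hlen : P.roots.toList.length = w := by
    rw [Multiset.length_toList, ← hP.natDegree_eq_card_roots, hw]
  subst hlen
  refine ⟨P.roots.toList.get, ?_⟩
  conv_lhs => rw [hP.eq_prod_roots, ← Multiset.coe_toList P.roots, Multiset.map_coe,
    Multiset.prod_coe, ← List.ofFn_get P.roots.toList, List.map_ofFn, List.prod_ofFn]
  rfl

theorem IsZeroList.toeplitz_eq_smul {p w : ℕ} {b : ℂ[T;T⁻¹]} {z : Fin w → ℂ}
    (hz : IsZeroList p w b z) (n : ℕ) :
    toeplitz n b = b.coeff (p : ℤ) • toeplitzBlock (esymmPoly Finset.univ z : ℂ⟦X⟧) p n n := by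
  rw [IsZeroList, prod_T_one_sub_C, mul_assoc, ← mul_assoc (LaurentPolynomial.T _),
    ← LaurentPolynomial.T_add, ← LaurentPolynomial.smul_eq_C_mul] at hz
  ext i j
  rw [toeplitz, Matrix.of_apply]
  conv_lhs => rw [hz]
  rw [AddMonoidAlgebra.coeff_smul, Finsupp.smul_apply, coeff_T_mul, LaurentPolynomial.invert_apply,
    coeff_toLaurent_eq_coeff_coe, Matrix.smul_apply, toeplitzBlock, Matrix.of_apply]
  congr 2
  rw [Finset.card_fin]
  ring

theorem IsBandedSymbol.exists_isZeroList {p w : ℕ} {b : ℂ[T;T⁻¹]} (hb : IsBandedSymbol p w b) :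
    ∃ z : Fin w → ℂ, IsZeroList p w b z := by
  set P : ℂ[X] := LaurentPolynomial.trunc (LaurentPolynomial.T ((w : ℤ) - p) * b) with hP
  have hbP : b = LaurentPolynomial.T ((p : ℤ) - w) * Polynomial.toLaurent P := by
    rw [hP, toLaurent_trunc, ← mul_assoc, ← LaurentPolynomial.T_add, sub_add_sub_cancel, sub_self,
      LaurentPolynomial.T_zero, one_mul]
    intro k hk
    rw [coeff_T_mul]
    exact hb.2 _ (Or.inl (by lia))
  have hcoeff (i : ℕ) : P.coeff i = b.coeff (i + (p - w)) := by
    rw [hbP, coeff_T_mul, coeff_toLaurent_eq_coeff_coe, add_sub_cancel_right,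
      LaurentSeries.coeff_coe_powerSeries, Polynomial.coeff_coe]
  have hcoeff_w : P.coeff w = b.coeff (p : ℤ) := by
    rw [hcoeff, add_sub_cancel]
  have hdeg : P.natDegree = w := by
    refine Polynomial.natDegree_eq_of_le_of_coeff_ne_zero ?_ (hcoeff_w ▸ hb.1)
    refine Polynomial.natDegree_le_iff_coeff_eq_zero.mpr fun i hi => ?_
    rw [hcoeff]
    exact hb.2 _ (Or.inr (by lia))
  obtain ⟨z, hz⟩ := exists_eq_C_leadingCoeff_mul_prod_X_sub_C (IsAlgClosed.splits P) hdeg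
  rw [Polynomial.leadingCoeff, hdeg, hcoeff_w] at hz
  refine ⟨z, ?_⟩
  rw [IsZeroList]
  conv_lhs => rw [hbP, hz]
  rw [map_mul, map_prod, Polynomial.toLaurent_C, mul_left_comm, mul_assoc]
  simp only [map_sub, Polynomial.toLaurent_X, Polynomial.toLaurent_C]

end LaurentPolynomials

section Eigenvalues

theorem coeff_sub_C_of_ne_zero (a : ℂ[T;T⁻¹]) (x : ℂ) {k : ℤ} (hk : k ≠ 0) :
    (a - LaurentPolynomial.C x).coeff k = a.coeff k := by
  rw [AddMonoidAlgebra.coeff_sub, Finsupp.sub_apply, LaurentPolynomial.C_apply, if_neg hk, sub_zero]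

theorem toeplitz_sub_C (n : ℕ) (a : ℂ[T;T⁻¹]) (x : ℂ) :
    toeplitz n (a - LaurentPolynomial.C x) = toeplitz n a - x • (1 : Matrix (Fin n) (Fin n) ℂ) := by
  ext i j
  rw [toeplitz, toeplitz, Matrix.of_apply, Matrix.sub_apply, Matrix.smul_apply, smul_eq_mul,
    Matrix.of_apply, AddMonoidAlgebra.coeff_sub, Finsupp.sub_apply, LaurentPolynomial.C_apply,
    Matrix.one_apply, mul_ite, mul_one, mul_zero]
  congr 2
  grind

variable {n : ℕ} {a : ℂ[T;T⁻¹]} {x : ℂ}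

theorem toeplitz_sub_C_mulVec_eq_zero_iff {v : Fin n → ℂ} :
    toeplitz n (a - LaurentPolynomial.C x) *ᵥ v = 0 ↔ toeplitz n a *ᵥ v = x • v := by
  rw [toeplitz_sub_C, Matrix.sub_mulVec, Matrix.smul_mulVec, Matrix.one_mulVec, sub_eq_zero]

theorem det_toeplitz_sub_C_eq_zero
    (hx : Module.End.HasEigenvalue (Matrix.toLin' (toeplitz n a)) x) :
    (toeplitz n (a - LaurentPolynomial.C x)).det = 0 := by
  obtain ⟨y, hy⟩ := hx.exists_hasEigenvector
  refine Matrix.exists_mulVec_eq_zero_iff.mp ⟨y, hy.2, toeplitz_sub_C_mulVec_eq_zero_iff.mpr ?_⟩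
  rw [← Matrix.toLin'_apply, hy.apply_eq_smul]

theorem det_toeplitz_of_coeff_eq_zero (ha : ∀ k < 0, a.coeff k = 0) :
    (toeplitz n a).det = a.coeff 0 ^ n := by
  rw [Matrix.det_of_isLowerTriangular]
  · simp [toeplitz]
  · intro i j hij
    have hij : (i : ℕ) < j := hij
    exact ha _ (by lia)

theorem IsBandedSymbol.sub_C {p w : ℕ} (hp : 1 ≤ p) (ha : IsBandedSymbol p w a)
    (hdet : (toeplitz n (a - LaurentPolynomial.C x)).det = 0) :
    IsBandedSymbol p w (a - LaurentPolynomial.C x) := by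
  rcases lt_or_ge w p with hwp | hwp
  · have hx : x = 0 := by
      rw [det_toeplitz_of_coeff_eq_zero fun k hk => by
        rw [coeff_sub_C_of_ne_zero a x hk.ne, ha.2 k (Or.inl (by lia))]] at hdet
      have hcoeff := eq_zero_of_pow_eq_zero hdet
      rwa [AddMonoidAlgebra.coeff_sub, Finsupp.sub_apply, LaurentPolynomial.C_apply, if_pos rfl,
        ha.2 0 (Or.inl (by lia)), zero_sub, neg_eq_zero] at hcoeff
    rwa [hx, map_zero, sub_zero]
  · refine ⟨?_, fun k hk => ?_⟩
    · rw [coeff_sub_C_of_ne_zero _ _ (by lia)]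
      exact ha.1
    · rw [coeff_sub_C_of_ne_zero _ _ (by lia)]
      exact ha.2 k hk

end Eigenvalues

end

theorem theorem3 (p w n : ℕ) (hp : 1 ≤ p) (hw : 1 ≤ w) (hn : 1 ≤ n)
    (a : ℂ[T;T⁻¹]) (ha : IsBandedSymbol p w a)
    (x : ℂ) (hx : Module.End.HasEigenvalue (Matrix.toLin' (toeplitz n a)) x) :
    -- the zeros of `a - x` exist
    (∃ z : Fin w → ℂ, IsZeroList p w (a - LaurentPolynomial.C x) z) ∧
    ∀ z : Fin w → ℂ, IsZeroList p w (a - LaurentPolynomial.C x) z →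
      ∀ v : Fin n → ℂ,
        -- the index `r` runs from `0` to `n - 1`, so that `n - r` becomes `n - (r + 1)`
        (∀ r : Fin n,
          v r = schurEval (List.replicate (p - 1) (n - 1) ++ [n - ((r : ℕ) + 1)]) z) →
        Matrix.mulVec (toeplitz n a) v = x • v ∧
        (p ≤ w → Function.Injective z →
          ∃ C : Fin w → ℂ, (∀ j : Fin w, C j = trenchCoeff n p z j) ∧
            ∀ r : Fin n, v r = ∑ j : Fin w, C j * z j ^ (n - ((r : ℕ) + 1) + (w - p))) := by
  obtain ⟨q, rfl⟩ := Nat.exists_eq_add_of_le' hp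
  obtain ⟨n, rfl⟩ := Nat.exists_eq_add_of_le' hn
  have hdet := det_toeplitz_sub_C_eq_zero hx
  have hb := ha.sub_C hp hdet
  refine ⟨hb.exists_isZeroList, fun z hz v hv => ⟨?_, fun hpw hinj =>
    ⟨trenchCoeff (n + 1) (q + 1) z, fun _ => rfl, fun r => ?_⟩⟩⟩
  · have hv_mulVec := (funext hv).trans (schurEval_replicate_append_eq_mulVec z q n)
    have hblock := hz.toeplitz_eq_smul (n + 1)
    rw [hblock, Matrix.det_smul] at hdet
    have hker := toeplitzBlock_mulVec_adjugate_col (esymmPoly_univ_mul_hsymmSeries z)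
      ((mul_eq_zero.mp hdet).resolve_left (pow_ne_zero _ hb.1)) 0
    rw [← toeplitz_sub_C_mulVec_eq_zero_iff, hblock, hv_mulVec, Matrix.smul_mulVec,
      Matrix.mulVec_smul, hker, smul_zero, smul_zero]
  · rw [hv r]
    exact schurEval_replicate_append_eq_sum_trenchCoeff hpw n _ hinj
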